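/- Let $\mathcal H$ be a complex Hilbert space, $n\ge 1$, and let $A_1,\dots,A_n$ be (possibly unbounded) selfadjoint operators in $\mathcal H$ such that $\mathcal D:=\mathcal D(A_1)\cap\dots\cap\mathcal D(A_n)$ is dense. Let $\mathcal C\subset\mathbb C$ be open and dense, let $f^{(1)},\dots,f^{(n)},g:\mathcal C\to\mathbb C$, and assume that for every $\omega\in\mathcal C$ the operator $\widehat T(\omega)=g(\omega)+\sum_{j=1}^n f^{(j)}(\omega)A_j$ with domain $\mathcal D$ is closable; let $T(\omega)$ be its closure. For $\alpha\in\mathbb R^n$ put $t_\alpha(\omega)=g(\omega)+\sum_{j=1}^n\alpha_jf^{(j)}(\omega)$, and for $X\subset\mathbb R^n$ and $\epsilon>0$ put $$W_X(T)=\{\omega\in\mathcal C:\exists\,\alpha\in X,\ t_\alpha(\omega)=0\},\qquad W_X^\epsilon(T)=\{\omega\in\mathcal C:\exists\,\alpha\in X,\ |t_\alpha(\omega)|<\epsilon\}.$$ Let $W(A_j)=\{\langle A_ju,u\rangle:u\in\mathcal D(A_j),\|u\|=1\}$, let $W(A_1,\dots,A_n)=\{(\langle A_1u,u\rangle,\dots,\langle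 A_nu,u\rangle):u\in\mathcal D,\|u\|=1\}$, and let $\Omega\subset\mathbb R^n$ be a closed set with $W(A_1,\dots,A_n)\subset\Omega\subset\overline{W(A_1)}\times\dots\times\overline{W(A_n)}$. For a closed set $\Omega\subset\mathbb R^n$ let $J_\Omega$ be the set of those $j$ for which $\alpha_j$ is unbounded both from below and from above on $\Omega$. The $m$-skeleton $\Omega_m$ is defined as follows. For $m<0$, $\Omega_m:=\Omega$. For $m\ge 0$ and $J_\Omega\ne\emptyset$, iteratively, $\Omega_m:=(\Omega^+)_m\cup(\Omega^-)_m$ with $\Omega^\pm:=\{\alpha\in\Omega:\pm\alpha_{\min J_\Omega}\ge 0\}$. For $J_\Omega=\emptyset$, $\Omega_0:=\partial\Omega$, and for $m>0$, $\Omega_m$ is the set of $\alpha\in\Omega$ for which there is an $m$-dimensional affine subspace $P$ with $\Omega\cap P=\{\alpha\}$. Let $\mathcal C^i$ be the set of $\omega\in\mathcal C$ at which the real $2\times n$ matrix with columns $(\operatorname{Re}f^{(j)}(\omega),\operatorname{Im}f^{(j)}(\omega))^{T}$ has rank less than $2$. Let $C$ be the set of points of $\mathcal C$ at which $f^{(1)},\dots,f^{(n)},g$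 are continuous. Fix $\epsilon>0$ and let $H$ be the set of points $\omega\in\mathcal C$ such that $f^{(1)},\dots,f^{(n)},g$ are holomorphic in a neighborhood of $\omega$ and linearly independent over $\mathbb R$ in every neighborhood of $\omega$, and such that for no $\alpha\in\Omega$ the function $|t_\alpha|$ is identically equal to $\epsilon$ in a neighborhood of $\omega$. If $n=2$ or $\Omega$ is convex or $\Omega$ is bounded, let $m:=n-2$; otherwise let $m:=n-3$. Then: (i) $W^\epsilon_{\Omega_m}(T)\setminus W_\Omega(T)=W^\epsilon_{\Omega}(T)\setminus W_\Omega(T)$; (ii) $\bigl(W^\epsilon_{\Omega_{n-2}}(T)\cap\mathcal C^i\bigr)\setminus W_\Omega(T)=\bigl(W^\epsilon_{\Omega}(T)\cap\mathcal C^i\bigr)\setminus W_\Omega(T)$; (iii) $\{\omega\in\partial W^\epsilon_\Omega(T)\cap C:\ \omega\notin\partial W^{\epsilon'}_\Omega(T)\text{ for all }\epsilon'>\epsilon\}\subset\{\omega\in C:\inf_{\alpha\in\Omega}|t_\alpha(\omega)|=\epsilon\}$; (iv) $\{\omega\in\partial W^\epsilon_\Omega(T)\cap H:\ \omega\notin\partial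 W^{\epsilon'}_\Omega(T)\text{ for all }\epsilon'>\epsilon\}=\{\omega\in H:\inf_{\alpha\in\Omega}|t_\alpha(\omega)|=\epsilon\}$. -/

import Mathlib

open Filter Topology

/-! ## Numerical ranges of (unbounded) selfadjoint operators -/

/-- The numerical range `W(A) = {⟨A u, u⟩ : u ∈ D(A), ‖u‖ = 1}` of an operator whose quadratic
form is real (such as a selfadjoint operator), as a subset of `ℝ`. -/
def numRange {E : Type*} [NormedAddCommGroup E] [InnerProductSpace ℂ E]
    (A : E →ₗ.[ℂ] E) : Set ℝ :=
  {x | ∃ u : A.domain, ‖(u : E)‖ = 1 ∧ (x : ℂ) = inner ℂ (u : E) (A u)}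

/-- `D(A₁) ∩ ⋯ ∩ D(Aₙ)`. -/
def commonDomain {E : Type*} [NormedAddCommGroup E] [InnerProductSpace ℂ E] {n : ℕ}
    (A : Fin n → E →ₗ.[ℂ] E) : Submodule ℂ E :=
  ⨅ j, (A j).domain

/-- The inclusion of the common domain into `D(Aⱼ)`. -/
def commonDomainIncl {E : Type*} [NormedAddCommGroup E] [InnerProductSpace ℂ E] {n : ℕ}
    (A : Fin n → E →ₗ.[ℂ] E) (j : Fin n) : commonDomain A →ₗ[ℂ] (A j).domain :=
  Submodule.inclusion (iInf_le (fun j => (A j).domain) j)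

/-- The joint numerical range
`W(A₁,…,Aₙ) = {(⟨A₁ u, u⟩, …, ⟨Aₙ u, u⟩) : u ∈ D(A₁) ∩ ⋯ ∩ D(Aₙ), ‖u‖ = 1} ⊆ ℝⁿ`. -/
def jointNumRange {E : Type*} [NormedAddCommGroup E] [InnerProductSpace ℂ E] {n : ℕ}
    (A : Fin n → E →ₗ.[ℂ] E) : Set (Fin n → ℝ) :=
  {α | ∃ u : commonDomain A, ‖(u : E)‖ = 1 ∧
    ∀ j, (α j : ℂ) = inner ℂ (u : E) (A j (commonDomainIncl A j u))}

/-- The operator `g(ω) + ∑ⱼ f⁽ʲ⁾(ω) Aⱼ` with domain `D(A₁) ∩ ⋯ ∩ D(Aₙ)`. -/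
noncomputable def preOperator {E : Type*} [NormedAddCommGroup E] [InnerProductSpace ℂ E] {n : ℕ}
    (A : Fin n → E →ₗ.[ℂ] E) (f : Fin n → ℂ → ℂ) (g : ℂ → ℂ) (ω : ℂ) : E →ₗ.[ℂ] E where
  domain := commonDomain A
  toFun := g ω • (commonDomain A).subtype +
    ∑ j, f j ω • ((A j).toFun ∘ₗ commonDomainIncl A j)

/-! ## The scalar functions and the enclosures -/

/-- `t_α(ω) = g(ω) + ∑ⱼ αⱼ f⁽ʲ⁾(ω)`. -/
noncomputable def tFun {n : ℕ} (f : Fin n → ℂ → ℂ) (g : ℂ → ℂ) (α : Fin n → ℝ) (ω : ℂ) : ℂ :=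
  g ω + ∑ j, (α j : ℂ) * f j ω

/-- `W_X(T) = {ω ∈ 𝒞 : ∃ α ∈ X, t_α(ω) = 0}`. -/
def enclosure {n : ℕ} (𝒞 : Set ℂ) (f : Fin n → ℂ → ℂ) (g : ℂ → ℂ)
    (X : Set (Fin n → ℝ)) : Set ℂ :=
  {ω | ω ∈ 𝒞 ∧ ∃ α ∈ X, tFun f g α ω = 0}

/-- `W_X^ε(T) = {ω ∈ 𝒞 : ∃ α ∈ X, |t_α(ω)| < ε}`. -/
def pseudoEnclosure {n : ℕ} (𝒞 : Set ℂ) (f : Fin n → ℂ → ℂ) (g : ℂ → ℂ)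
    (X : Set (Fin n → ℝ)) (ε : ℝ) : Set ℂ :=
  {ω | ω ∈ 𝒞 ∧ ∃ α ∈ X, ‖tFun f g α ω‖ < ε}

/-- `inf_{α ∈ X} |t_α(ω)|` (for nonempty `X`; the value at `X = ∅` is `0`). -/
noncomputable def infModulus {n : ℕ} (f : Fin n → ℂ → ℂ) (g : ℂ → ℂ)
    (X : Set (Fin n → ℝ)) (ω : ℂ) : ℝ :=
  sInf ((fun α => ‖tFun f g α ω‖) '' X)

/-- The real `2 × n` matrix `F(ω)` with rows `Re f⁽ʲ⁾(ω)` and `Im f⁽ʲ⁾(ω)`. -/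
noncomputable def coeffMatrix {n : ℕ} (f : Fin n → ℂ → ℂ) (ω : ℂ) : Matrix (Fin 2) (Fin n) ℝ :=
  Matrix.of ![fun j => (f j ω).re, fun j => (f j ω).im]

/-- `𝒞ⁱ = {ω ∈ 𝒞 : rank F(ω) < 2}`. -/
def degenerateSet {n : ℕ} (𝒞 : Set ℂ) (f : Fin n → ℂ → ℂ) : Set ℂ :=
  {ω | ω ∈ 𝒞 ∧ (coeffMatrix f ω).rank < 2}

/-- The set `C` of points of `𝒞` at which `f⁽¹⁾, …, f⁽ⁿ⁾, g` are continuous. -/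
def contSet {n : ℕ} (𝒞 : Set ℂ) (f : Fin n → ℂ → ℂ) (g : ℂ → ℂ) : Set ℂ :=
  {ω | ω ∈ 𝒞 ∧ ContinuousAt g ω ∧ ∀ j, ContinuousAt (f j) ω}

/-- The set `H` of points of `𝒞` at which `g, f⁽¹⁾, …, f⁽ⁿ⁾` are holomorphic and linearly
independent (over `ℝ`, as germs), and near which none of the functions `|t_α|`, `α ∈ Ω`,
is identically equal to `ε`. -/
def holoSet {n : ℕ} (𝒞 : Set ℂ) (f : Fin n → ℂ → ℂ) (g : ℂ → ℂ)
    (Ω : Set (Fin n → ℝ)) (ε : ℝ) : Set ℂ :=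
  {ω | ω ∈ 𝒞 ∧ AnalyticAt ℂ g ω ∧ (∀ j, AnalyticAt ℂ (f j) ω) ∧
    LinearIndependent ℝ (fun i : Fin (n + 1) =>
      (((Fin.cons g f : Fin (n + 1) → ℂ → ℂ) i : ℂ → ℂ) : Germ (𝓝 ω) ℂ)) ∧
    ∀ α ∈ Ω, ¬ ∀ᶠ z in 𝓝 ω, ‖tFun f g α z‖ = ε}

/-! ## Skeletons -/

/-- `J_Ω`: the coordinates that are unbounded on `Ω` both from below and from above. -/
noncomputable def unbddCoords {n : ℕ} (Ω : Set (Fin n → ℝ)) : Finset (Fin n) := by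
  classical
  exact Finset.univ.filter fun j =>
    ¬ BddBelow ((fun α => α j) '' Ω) ∧ ¬ BddAbove ((fun α => α j) '' Ω)

theorem mem_unbddCoords {n : ℕ} {Ω : Set (Fin n → ℝ)} {j : Fin n} :
    j ∈ unbddCoords Ω ↔
      ¬ BddBelow ((fun α => α j) '' Ω) ∧ ¬ BddAbove ((fun α => α j) '' Ω) := by
  classical
  simp [unbddCoords]

theorem unbddCoords_mono {n : ℕ} {Ω Ω' : Set (Fin n → ℝ)} (h : Ω' ⊆ Ω) :
    unbddCoords Ω' ⊆ unbddCoords Ω := by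
  intro j hj
  rw [mem_unbddCoords] at hj ⊢
  exact ⟨fun hb => hj.1 (hb.mono (Set.image_mono h)),
    fun hb => hj.2 (hb.mono (Set.image_mono h))⟩

theorem card_unbddCoords_nonneg_lt {n : ℕ} {Ω : Set (Fin n → ℝ)} {j : Fin n}
    (hj : j ∈ unbddCoords Ω) :
    (unbddCoords {α ∈ Ω | 0 ≤ α j}).card < (unbddCoords Ω).card := by
  refine Finset.card_lt_card ⟨unbddCoords_mono (Set.sep_subset _ _), fun h => ?_⟩
  refine (mem_unbddCoords.1 (h hj)).1 ⟨0, ?_⟩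
  rintro _ ⟨α, hα, rfl⟩
  exact hα.2

theorem card_unbddCoords_nonpos_lt {n : ℕ} {Ω : Set (Fin n → ℝ)} {j : Fin n}
    (hj : j ∈ unbddCoords Ω) :
    (unbddCoords {α ∈ Ω | α j ≤ 0}).card < (unbddCoords Ω).card := by
  refine Finset.card_lt_card ⟨unbddCoords_mono (Set.sep_subset _ _), fun h => ?_⟩
  refine (mem_unbddCoords.1 (h hj)).2 ⟨0, ?_⟩
  rintro _ ⟨α, hα, rfl⟩
  exact hα.2

/-- The `m`-skeleton of a set with `J_Ω = ∅`: the boundary if `m = 0`, and for `m > 0` the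
points `α ∈ Ω` such that some `m`-dimensional affine subspace meets `Ω` exactly in `α`. -/
def baseSkeleton {n : ℕ} (m : ℕ) (Ω : Set (Fin n → ℝ)) : Set (Fin n → ℝ) :=
  if m = 0 then frontier Ω
  else {α | α ∈ Ω ∧ ∃ P : AffineSubspace ℝ (Fin n → ℝ),
    Module.finrank ℝ P.direction = m ∧ Ω ∩ (P : Set (Fin n → ℝ)) = {α}}

/-- The `m`-skeleton `Ω_m` for `m ≥ 0`: if `J_Ω ≠ ∅` it is `Ω⁺_m ∪ Ω⁻_m`, where
`Ω^± = {α ∈ Ω : ± α_{min J_Ω} ≥ 0}`. -/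
noncomputable def natSkeleton {n : ℕ} (m : ℕ) (Ω : Set (Fin n → ℝ)) : Set (Fin n → ℝ) :=
  if h : (unbddCoords Ω).Nonempty then
    natSkeleton m {α ∈ Ω | 0 ≤ α ((unbddCoords Ω).min' h)} ∪
      natSkeleton m {α ∈ Ω | α ((unbddCoords Ω).min' h) ≤ 0}
  else baseSkeleton m Ω
termination_by (unbddCoords Ω).card
decreasing_by
  · exact card_unbddCoords_nonneg_lt (Finset.min'_mem _ h)
  · exact card_unbddCoords_nonpos_lt (Finset.min'_mem _ h)

/-- The `m`-skeleton `Ω_m`, with the convention `Ω_m = Ω` for `m < 0`. -/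
noncomputable def skeleton {n : ℕ} (m : ℤ) (Ω : Set (Fin n → ℝ)) : Set (Fin n → ℝ) :=
  if m < 0 then Ω else natSkeleton m.toNat Ω

open Classical in
/-- `n - 2` if `n = 2` or `Ω ⊆ ℝⁿ` is convex or bounded, and `n - 3` otherwise. -/
noncomputable def skeletonIndex {n : ℕ} (Ω : Set (Fin n → ℝ)) : ℤ :=
  if n = 2 ∨ Convex ℝ Ω ∨ Bornology.IsBounded Ω then (n : ℤ) - 2 else (n : ℤ) - 3

/-! For fixed `ω`, `t_α(ω) = c + L α` is affine in `α`. Parts (i) and (ii) ask to move a given `α ∈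
Ω` into a skeleton while keeping `|c + L α| < ε`. Cutting by coordinate half-spaces
(`exists_mem_natSkeleton`) reduces this to sets with every coordinate bounded on one side. There,
minimizing a linear functional plus a small sum of square roots gives a minimizer; strict concavity
makes a linear functional isolate it (`exists_strict_minimizer`), so its kernel supplies the plane
that defines the skeleton. If `dim ker L > m`, one moves inside a fibre of `L` and the value does
not change; this gives (ii) and the index `n - 3`. For `n - 2` one fixes only the argument of the
value, up to sign, gaining a dimension. Convexity or boundedness, together with the absence of
zeros, keeps points with negative value off the isolating plane. In dimension two a connectedness
argument reaches the frontier. For (iii), compare the infimum with `ε`: below `ε`, `ω` is interior;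
above, `ω` lies on the boundary for some `ε' > ε`. For (iv), if `ω` were not in the closure, all
`|t_α|` would be at least `ε` near `ω`. Then `isBounded_setOf_norm_tFun_le` makes the infimum
attained, and the minimum modulus principle makes some `|t_α|` locally equal to `ε`, which `H`
excludes. -/

/-! ### Strict minimizers by concave perturbation -/

/-- If every coordinate is bounded from one side on `Ω`, then after reflections and translations
all coordinates are at least `1` on `Ω`. -/
theorem exists_signs_of_unbddCoords_eq_empty {n : ℕ} {Ω : Set (Fin n → ℝ)}
    (hJ : ¬ (unbddCoords Ω).Nonempty) :
    ∃ σ c : Fin n → ℝ, (∀ j, |σ j| = 1) ∧ ∀ y ∈ Ω, ∀ j, 1 ≤ σ j * y j + c j := by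
  have h : ∀ j, ∃ s c : ℝ, |s| = 1 ∧ ∀ y ∈ Ω, 1 ≤ s * y j + c := by
    intro j
    have hj : j ∉ unbddCoords Ω := fun hj => hJ ⟨j, hj⟩
    rw [mem_unbddCoords, not_and_or, not_not, not_not] at hj
    rcases hj with ⟨b, hb⟩ | ⟨b, hb⟩
    · refine ⟨1, 1 - b, by simp, fun y hy => ?_⟩
      have := hb ⟨y, hy, rfl⟩
      simp only at this
      linarith
    · refine ⟨-1, 1 + b, by simp, fun y hy => ?_⟩
      have := hb ⟨y, hy, rfl⟩
      simp only at this
      linarith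
  choose s c hs hc using h
  exact ⟨s, c, hs, fun y hy j => hc j y hy⟩

theorem sqrt_lt_linearization {a b : ℝ} (ha : 1 ≤ a) (hb : 1 ≤ b) (hab : b ≠ a) :
    √b < √a + (b - a) / (2 * √a) := by
  have ha' : 0 < √a := Real.sqrt_pos.2 (by linarith)
  have hne : √b - √a ≠ 0 := fun h =>
    hab ((Real.sqrt_inj (by linarith) (by linarith)).1 (by linarith))
  have h1 := Real.sq_sqrt (show 0 ≤ a by linarith)
  have h2 := Real.sq_sqrt (show 0 ≤ b by linarith)
  have h3 : 0 < (√b - √a) ^ 2 := by positivity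
  have h4 : √b - √a < (b - a) / (2 * √a) := by
    rw [lt_div_iff₀ (by positivity)]
    nlinarith
  linarith

theorem sqrt_le_linearization {a b : ℝ} (ha : 1 ≤ a) (hb : 1 ≤ b) :
    √b ≤ √a + (b - a) / (2 * √a) := by
  rcases eq_or_ne b a with rfl | h
  · simp
  · exact (sqrt_lt_linearization ha hb h).le

/-- On a closed set contained in a shifted orthant, a linear functional that is bounded below
almost attains its infimum at a point which is the strict minimizer of a small linear
perturbation. -/
theorem exists_strict_minimizer {n : ℕ} {Q : Set (Fin n → ℝ)} (hQ : IsClosed Q)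
    {σ c : Fin n → ℝ} (hσ : ∀ j, |σ j| = 1) (hz : ∀ y ∈ Q, ∀ j, 1 ≤ σ j * y j + c j)
    (l : (Fin n → ℝ) →ₗ[ℝ] ℝ) {b : ℝ} (hb : ∀ y ∈ Q, b ≤ l y) {α : Fin n → ℝ} (hα : α ∈ Q)
    {δ : ℝ} (hδ : 0 < δ) :
    ∃ x ∈ Q, l x ≤ l α + δ * ∑ j, √(σ j * α j + c j) ∧
      ∃ d : Fin n → ℝ, (∀ j, |d j| ≤ 1) ∧
        ∀ y ∈ Q, y ≠ x → 0 < l (y - x) + δ * ∑ j, d j * (y j - x j) := by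
  -- The square roots make the sublevel sets bounded, and by strict concavity they lie below their
  -- tangents.
  set F : (Fin n → ℝ) → ℝ := fun y => l y + δ * ∑ j, √(σ j * y j + c j) with hF
  have hl : Continuous l := l.continuous_of_finiteDimensional
  have hFc : Continuous F := by fun_prop
  set K : Set (Fin n → ℝ) := Q ∩ {y | F y ≤ F α} with hK
  have hKc : IsClosed K := hQ.inter (isClosed_le hFc continuous_const)
  set R : ℝ := ((F α - b) / δ) ^ 2 with hR
  have hKb : Bornology.IsBounded K := by
    rw [Metric.isBounded_iff_subset_closedBall 0]
    refine ⟨R + ∑ j, |c j|, fun y hy => ?_⟩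
    rw [mem_closedBall_zero_iff]
    have hcs : ∀ j, |c j| ≤ ∑ j, |c j| := fun j =>
      Finset.single_le_sum (f := fun j => |c j|) (fun i _ => abs_nonneg _) (Finset.mem_univ j)
    refine (pi_norm_le_iff_of_nonneg (by positivity)).2 fun j => ?_
    have h1 : √(σ j * y j + c j) ≤ (F α - b) / δ := by
      rw [le_div_iff₀ hδ]
      have h2 : √(σ j * y j + c j) ≤ ∑ j, √(σ j * y j + c j) :=
        Finset.single_le_sum (f := fun j => √(σ j * y j + c j))
          (fun i _ => Real.sqrt_nonneg _) (Finset.mem_univ j)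
      have h3 := hb y hy.1
      have h4 : F y ≤ F α := hy.2
      have h5 : F y = l y + δ * ∑ j, √(σ j * y j + c j) := rfl
      nlinarith
    have h0 := hz y hy.1 j
    have h6 : σ j * y j + c j ≤ R := by
      rw [← Real.sq_sqrt (show 0 ≤ σ j * y j + c j by linarith)]
      exact pow_le_pow_left₀ (Real.sqrt_nonneg _) h1 2
    have h7 : |σ j * y j| = |y j| := by rw [abs_mul, hσ, one_mul]
    rw [Real.norm_eq_abs, ← h7, abs_le]
    have := hcs j
    have := abs_le.1 (le_refl |c j|)
    constructor <;> linarith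
  obtain ⟨x, hxK, hx⟩ := (Metric.isCompact_of_isClosed_isBounded hKc hKb).exists_isMinOn
    ⟨α, hα, le_refl (F α)⟩ hFc.continuousOn
  have hmin : ∀ y ∈ Q, F x ≤ F y := by
    intro y hy
    by_cases h : F y ≤ F α
    · exact hx ⟨hy, h⟩
    · exact (hxK.2 : F x ≤ F α).trans (not_le.1 h).le
  -- `d` is the gradient of the square-root sum at `x`; its entries are small because the radicands
  -- are at least `1`.
  refine ⟨x, hxK.1, ?_, fun j => σ j / (2 * √(σ j * x j + c j)), fun j => ?_,
    fun y hy hyx => ?_⟩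
  · have h1 : F x ≤ F α := hxK.2
    have h2 : 0 ≤ δ * ∑ j, √(σ j * x j + c j) :=
      mul_nonneg hδ.le (Finset.sum_nonneg fun i _ => Real.sqrt_nonneg _)
    simp only [hF] at h1
    linarith
  · have h1 : 1 ≤ √(σ j * x j + c j) := by
      rw [Real.one_le_sqrt]; exact hz x hxK.1 j
    rw [abs_div, hσ, abs_of_pos (by linarith), div_le_one (by linarith)]
    linarith
  · have h1 := hmin y hy
    obtain ⟨i, hi⟩ : ∃ i, y i ≠ x i := Function.ne_iff.1 hyx
    have hσ0 : ∀ j, σ j ≠ 0 := fun j h => by simpa [h] using hσ j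
    have hlin : ∀ j, σ j / (2 * √(σ j * x j + c j)) * (y j - x j) =
        ((σ j * y j + c j) - (σ j * x j + c j)) / (2 * √(σ j * x j + c j)) := fun j => by ring
    have h2 : ∑ j, √(σ j * y j + c j) < ∑ j, (√(σ j * x j + c j) +
        σ j / (2 * √(σ j * x j + c j)) * (y j - x j)) := by
      refine Finset.sum_lt_sum (fun j _ => ?_) ⟨i, Finset.mem_univ i, ?_⟩
      · rw [hlin]
        exact sqrt_le_linearization (hz x hxK.1 j) (hz y hy j)
      · rw [hlin]
        refine sqrt_lt_linearization (hz x hxK.1 i) (hz y hy i) fun h => hi ?_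
        exact mul_left_cancel₀ (hσ0 i) (by linarith)
    rw [Finset.sum_add_distrib] at h2
    have h3 := mul_lt_mul_of_pos_left h2 hδ
    simp only [hF] at h1
    rw [map_sub]
    linarith

/-! ### Reaching the skeleton when coordinates are bounded on one side -/

/-- A point of `Ω` that a linear functional isolates within a translate of `V` lies in the
skeleton of dimension `dim V - 1` and below. -/
theorem mem_baseSkeleton_of_isolated {n m : ℕ} (hm : m ≠ 0) {Ω : Set (Fin n → ℝ)}
    {x : Fin n → ℝ} (hx : x ∈ Ω) (V : Submodule ℝ (Fin n → ℝ))
    (hV : m + 1 ≤ Module.finrank ℝ V) (p : (Fin n → ℝ) →ₗ[ℝ] ℝ)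
    (h : ∀ y ∈ Ω, y - x ∈ V → p (y - x) = 0 → y = x) : x ∈ baseSkeleton m Ω := by
  -- Restricting to `ker p` costs at most one dimension of `V`, which leaves room for an
  -- `m`-dimensional `U`.
  have h1 := LinearMap.finrank_range_add_finrank_ker (p.comp V.subtype)
  have h2 : Module.finrank ℝ (LinearMap.range (p.comp V.subtype)) ≤ 1 := by
    simpa using Submodule.finrank_le (LinearMap.range (p.comp V.subtype))
  set U₀ : Submodule ℝ (Fin n → ℝ) := (LinearMap.ker (p.comp V.subtype)).map V.subtype
  have h3 : Module.finrank ℝ U₀ = Module.finrank ℝ (LinearMap.ker (p.comp V.subtype)) :=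
    Submodule.finrank_map_subtype_eq _ _
  obtain ⟨v, hv⟩ := exists_linearIndependent_of_le_finrank (R := ℝ) (M := U₀) (n := m) (by omega)
  have hU : Submodule.span ℝ (Set.range fun i => (v i : Fin n → ℝ)) ≤ U₀ := by
    rw [Submodule.span_le]
    rintro _ ⟨i, rfl⟩
    exact (v i).2
  have hUm := finrank_span_eq_card (hv.map' U₀.subtype U₀.ker_subtype)
  rw [Fintype.card_fin] at hUm
  generalize hUdef : Submodule.span ℝ (Set.range fun i => (v i : Fin n → ℝ)) = U at hU
  replace hUm : Module.finrank ℝ U = m := hUdef ▸ hUm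
  rw [baseSkeleton, if_neg hm]
  refine ⟨hx, AffineSubspace.mk' x U, by rw [AffineSubspace.direction_mk', hUm], ?_⟩
  ext y
  simp only [Set.mem_inter_iff, SetLike.mem_coe, AffineSubspace.mem_mk', vsub_eq_sub,
    Set.mem_singleton_iff]
  constructor
  · rintro ⟨hy, hyU⟩
    obtain ⟨⟨v, hv⟩, hvp, hvy⟩ := hU hyU
    simp only [Submodule.subtype_apply] at hvy
    exact h y hy (hvy ▸ hv) (hvy ▸ hvp)
  · rintro rfl
    exact ⟨hx, by simp⟩

/-- Along the line some coordinate runs through all of `ℝ`, while on `Ω` it is bounded on one side;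
the chosen `t` makes the normalized coordinate `0 < 1`. -/
theorem exists_add_smul_notMem {n : ℕ} {Ω : Set (Fin n → ℝ)}
    (hJ : ¬ (unbddCoords Ω).Nonempty) (α : Fin n → ℝ) {v : Fin n → ℝ} (hv : v ≠ 0) :
    ∃ t : ℝ, α + t • v ∉ Ω := by
  obtain ⟨σ, c, hσ, hz⟩ := exists_signs_of_unbddCoords_eq_empty hJ
  by_contra! hcon
  obtain ⟨i, hi⟩ : ∃ i, v i ≠ 0 := Function.ne_iff.1 hv
  have hσ0 : σ i ≠ 0 := fun h => by simpa [h] using hσ i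
  have := hz _ (hcon (-(σ i * α i + c i) / (σ i * v i))) i
  simp only [Pi.add_apply, Pi.smul_apply, smul_eq_mul] at this
  have h2 : σ i * (α i + -(σ i * α i + c i) / (σ i * v i) * v i) + c i = 0 := by
    field_simp
    ring
  linarith

theorem inter_frontier_nonempty_of_isPreconnected {X : Type*} [TopologicalSpace X] {s t : Set X}
    (ht : IsPreconnected t) (h1 : (t ∩ s).Nonempty) (h2 : (t ∩ sᶜ).Nonempty) :
    (t ∩ frontier s).Nonempty := by
  by_contra hne
  have hfr : ∀ x ∈ t, x ∉ frontier s := fun x hx hxs => hne ⟨x, hx, hxs⟩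
  obtain ⟨x, hxt, hxs⟩ := h1
  obtain ⟨y, hyt, hys⟩ := h2
  have hint : ∀ z ∈ t, z ∈ closure s → z ∈ interior s := fun z hz hzs => by
    by_contra h
    exact hfr z hz ⟨hzs, h⟩
  obtain ⟨z, -, hz1, hz2⟩ := ht (interior s) (closure s)ᶜ isOpen_interior
    isClosed_closure.isOpen_compl
    (fun z hz => (em (z ∈ closure s)).imp (hint z hz) id)
    ⟨x, hxt, hint x hxt (subset_closure hxs)⟩
    ⟨y, hyt, fun h => hys (interior_subset (hint y hyt h))⟩
  exact hz2 (subset_closure (interior_subset hz1))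

theorem exists_mem_baseSkeleton_sub_mem {n m : ℕ} {Ω : Set (Fin n → ℝ)} (hΩ : IsClosed Ω)
    (hJ : ¬ (unbddCoords Ω).Nonempty) (V : Submodule ℝ (Fin n → ℝ))
    (hV : m + 1 ≤ Module.finrank ℝ V) {α : Fin n → ℝ} (hα : α ∈ Ω) :
    ∃ x ∈ baseSkeleton m Ω, x - α ∈ V := by
  rcases eq_or_ne m 0 with rfl | hm
  · obtain ⟨v, hvV, hv⟩ : ∃ v ∈ V, v ≠ 0 := by
      refine V.exists_mem_ne_zero_of_ne_bot fun h => ?_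
      simp [h] at hV
    obtain ⟨t, ht⟩ := exists_add_smul_notMem hJ α hv
    have hpre : IsPreconnected (Set.range fun s : ℝ => α + s • v) :=
      isPreconnected_range (by fun_prop)
    obtain ⟨_, ⟨s, rfl⟩, hs⟩ := inter_frontier_nonempty_of_isPreconnected hpre
      ⟨α, ⟨0, by simp⟩, hα⟩ ⟨_, ⟨t, rfl⟩, ht⟩
    exact ⟨_, by simpa [baseSkeleton] using hs, by simpa using V.smul_mem s hvV⟩
  · obtain ⟨σ, c, hσ, hz⟩ := exists_signs_of_unbddCoords_eq_empty hJ
    have hQ : IsClosed (Ω ∩ {y | y - α ∈ V}) :=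
      hΩ.inter (V.closed_of_finiteDimensional.preimage (by fun_prop : Continuous fun y => y - α))
    -- With `l = 0` the square roots alone are minimized on `Ω ∩ (α + V)`.
    obtain ⟨x, hx, -, d, -, hd⟩ := exists_strict_minimizer hQ hσ (fun y hy => hz y hy.1) 0
      (b := 0) (by simp) (α := α) ⟨hα, by simp⟩ one_pos
    refine ⟨x, mem_baseSkeleton_of_isolated hm hx.1 V hV
      (∑ j, d j • LinearMap.proj j) fun y hy hyV hp => ?_, hx.2⟩
    by_contra hyx
    have := hd y ⟨hy, by simpa using V.add_mem hyV hx.2⟩ hyx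
    simp at this hp
    linarith

/-! ### Induction on the unbounded coordinates -/

theorem baseSkeleton_subset {n m : ℕ} {Ω : Set (Fin n → ℝ)} (hΩ : IsClosed Ω) :
    baseSkeleton m Ω ⊆ Ω := by
  rw [baseSkeleton]
  split_ifs
  · exact hΩ.frontier_subset
  · exact fun x hx => hx.1

theorem isClosed_sep_nonneg {n : ℕ} {Ω : Set (Fin n → ℝ)} (hΩ : IsClosed Ω) (j : Fin n) :
    IsClosed {α ∈ Ω | 0 ≤ α j} :=
  hΩ.inter (isClosed_le continuous_const (continuous_apply j))

theorem isClosed_sep_nonpos {n : ℕ} {Ω : Set (Fin n → ℝ)} (hΩ : IsClosed Ω) (j : Fin n) :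
    IsClosed {α ∈ Ω | α j ≤ 0} :=
  hΩ.inter (isClosed_le (continuous_apply j) continuous_const)

theorem natSkeleton_subset {n : ℕ} (m : ℕ) (Ω : Set (Fin n → ℝ)) (hΩ : IsClosed Ω) :
    natSkeleton m Ω ⊆ Ω := by
  rw [natSkeleton]
  split_ifs with h
  · exact Set.union_subset
      ((natSkeleton_subset m _ (isClosed_sep_nonneg hΩ _)).trans (Set.sep_subset _ _))
      ((natSkeleton_subset m _ (isClosed_sep_nonpos hΩ _)).trans (Set.sep_subset _ _))
  · exact baseSkeleton_subset hΩ
termination_by (unbddCoords Ω).card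
decreasing_by
  · exact card_unbddCoords_nonneg_lt (Finset.min'_mem _ h)
  · exact card_unbddCoords_nonpos_lt (Finset.min'_mem _ h)

theorem skeleton_subset {n : ℕ} (m : ℤ) {Ω : Set (Fin n → ℝ)} (hΩ : IsClosed Ω) :
    skeleton m Ω ⊆ Ω := by
  rw [skeleton]
  split_ifs
  · exact subset_rfl
  · exact natSkeleton_subset _ _ hΩ

/-- To find points of the skeleton with a given property it suffices to treat sets all of whose
coordinates are bounded from one side. -/
theorem exists_mem_natSkeleton {n : ℕ} (m : ℕ) (S : Set (Fin n → ℝ) → Prop)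
    (R : (Fin n → ℝ) → Prop)
    (hnonneg : ∀ Ω j, S Ω → S {α ∈ Ω | 0 ≤ α j}) (hnonpos : ∀ Ω j, S Ω → S {α ∈ Ω | α j ≤ 0})
    (hbase : ∀ Ω, S Ω → ¬ (unbddCoords Ω).Nonempty → ∀ α ∈ Ω, R α → ∃ x ∈ baseSkeleton m Ω, R x)
    (Ω : Set (Fin n → ℝ)) (hΩ : S Ω) (α : Fin n → ℝ) (hα : α ∈ Ω) (hR : R α) :
    ∃ x ∈ natSkeleton m Ω, R x := by
  rw [natSkeleton]
  split_ifs with h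
  · rcases le_total 0 (α ((unbddCoords Ω).min' h)) with h0 | h0
    · obtain ⟨x, hx, hxR⟩ := exists_mem_natSkeleton m S R hnonneg hnonpos hbase _
        (hnonneg Ω ((unbddCoords Ω).min' h) hΩ) α ⟨hα, h0⟩ hR
      exact ⟨x, Or.inl hx, hxR⟩
    · obtain ⟨x, hx, hxR⟩ := exists_mem_natSkeleton m S R hnonneg hnonpos hbase _
        (hnonpos Ω ((unbddCoords Ω).min' h) hΩ) α ⟨hα, h0⟩ hR
      exact ⟨x, Or.inr hx, hxR⟩
  · exact hbase Ω hΩ h α hα hR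
termination_by (unbddCoords Ω).card
decreasing_by
  · exact card_unbddCoords_nonneg_lt (Finset.min'_mem _ h)
  · exact card_unbddCoords_nonpos_lt (Finset.min'_mem _ h)

theorem convex_sep_nonneg {n : ℕ} {Ω : Set (Fin n → ℝ)} (hΩ : Convex ℝ Ω) (j : Fin n) :
    Convex ℝ {α ∈ Ω | 0 ≤ α j} :=
  hΩ.inter (convex_halfSpace_ge (LinearMap.proj (R := ℝ) (φ := fun _ : Fin n => ℝ) j).isLinear 0)

theorem convex_sep_nonpos {n : ℕ} {Ω : Set (Fin n → ℝ)} (hΩ : Convex ℝ Ω) (j : Fin n) :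
    Convex ℝ {α ∈ Ω | α j ≤ 0} :=
  hΩ.inter (convex_halfSpace_le (LinearMap.proj (R := ℝ) (φ := fun _ : Fin n => ℝ) j).isLinear 0)

/-- The value of an affine map can be kept fixed while moving into a skeleton whose dimension is
smaller than that of the kernel. -/
theorem exists_mem_natSkeleton_eq {n m : ℕ} {Ω : Set (Fin n → ℝ)} (hΩ : IsClosed Ω)
    (L : (Fin n → ℝ) →ₗ[ℝ] ℂ) (hL : m + 1 ≤ Module.finrank ℝ (LinearMap.ker L))
    {α : Fin n → ℝ} (hα : α ∈ Ω) : ∃ x ∈ natSkeleton m Ω, L x = L α := by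
  refine exists_mem_natSkeleton m IsClosed (fun x => L x = L α)
    (fun Ω j h => isClosed_sep_nonneg h j) (fun Ω j h => isClosed_sep_nonpos h j)
    (fun Ω' hΩ' hJ y hy hyα => ?_) Ω hΩ α hα rfl
  obtain ⟨x, hx, hxy⟩ := exists_mem_baseSkeleton_sub_mem hΩ' hJ _ hL hy
  rw [LinearMap.mem_ker, map_sub, sub_eq_zero] at hxy
  exact ⟨x, hx, hxy.trans hyα⟩

theorem le_finrank_ker_add_two {n : ℕ} (L : (Fin n → ℝ) →ₗ[ℝ] ℂ) :
    n ≤ Module.finrank ℝ (LinearMap.ker L) + 2 := by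
  have h1 := LinearMap.finrank_range_add_finrank_ker L
  have h2 := Submodule.finrank_le (LinearMap.range L)
  rw [Complex.finrank_real_complex] at h2
  simp at h1
  omega

theorem le_finrank_ker_add_one {n : ℕ} (p : (Fin n → ℝ) →ₗ[ℝ] ℝ) :
    n ≤ Module.finrank ℝ (LinearMap.ker p) + 1 := by
  have h1 := LinearMap.finrank_range_add_finrank_ker p
  have h2 := Submodule.finrank_le (LinearMap.range p)
  simp at h1 h2
  omega

/-! ### Approximate values on the `(n-2)`-skeleton -/

/-- The convex set `‖c + L x‖ < ε` leaves `Ω`: at the zero of `c + L` if `L` is bijective, along a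
kernel line otherwise. Being connected, it meets the frontier. -/
theorem exists_mem_frontier_norm_lt {Ω : Set (Fin 2 → ℝ)}
    (hJ : ¬ (unbddCoords Ω).Nonempty) (L : (Fin 2 → ℝ) →ₗ[ℝ] ℂ) (c : ℂ)
    (h0 : ∀ x ∈ Ω, c + L x ≠ 0) {ε : ℝ} {α : Fin 2 → ℝ} (hα : α ∈ Ω) (hαε : ‖c + L α‖ < ε) :
    ∃ x ∈ frontier Ω, ‖c + L x‖ < ε := by
  have hconv : Convex ℝ {x | ‖c + L x‖ < ε} := by
    have h : {x | ‖c + L x‖ < ε} = L ⁻¹' Metric.ball (-c) ε := by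
      ext x
      simp [dist_eq_norm, add_comm]
    rw [h]
    exact (convex_ball (-c) ε).linear_preimage L
  obtain ⟨y, hy, hyΩ⟩ : ∃ y, ‖c + L y‖ < ε ∧ y ∉ Ω := by
    by_cases hk : LinearMap.ker L = ⊥
    · obtain ⟨y, hy⟩ := (LinearMap.injective_iff_surjective_of_finrank_eq_finrank
        (by simp [Complex.finrank_real_complex])).1 (LinearMap.ker_eq_bot.1 hk) (-c)
      have hy0 : c + L y = 0 := by rw [hy, add_neg_cancel]
      exact ⟨y, by rw [hy0, norm_zero]; exact (norm_nonneg _).trans_lt hαε, fun h => h0 y h hy0⟩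
    · obtain ⟨v, hv, hv0⟩ := Submodule.exists_mem_ne_zero_of_ne_bot hk
      obtain ⟨t, ht⟩ := exists_add_smul_notMem hJ α hv0
      refine ⟨_, ?_, ht⟩
      rwa [map_add, map_smul, LinearMap.mem_ker.1 hv, smul_zero, add_zero]
  obtain ⟨x, hx, hxf⟩ := inter_frontier_nonempty_of_isPreconnected hconv.isPreconnected
    ⟨α, hαε, hα⟩ ⟨y, hy, hyΩ⟩
  exact ⟨x, hxf, hx⟩

/-- The core of the enclosure of pseudonumerical ranges by the `(n-2)`-skeleton. -/
theorem exists_mem_baseSkeleton_norm_lt {n m : ℕ} (hm : m ≠ 0) (hmn : m + 2 = n)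
    {Ω : Set (Fin n → ℝ)} (hΩ : IsClosed Ω) (hΩ' : Convex ℝ Ω ∨ Bornology.IsBounded Ω)
    (hJ : ¬ (unbddCoords Ω).Nonempty) (L : (Fin n → ℝ) →ₗ[ℝ] ℂ) (c : ℂ)
    (h0 : ∀ x ∈ Ω, c + L x ≠ 0) {ε : ℝ} {α : Fin n → ℝ} (hα : α ∈ Ω) (hαε : ‖c + L α‖ < ε) :
    ∃ x ∈ baseSkeleton m Ω, ‖c + L x‖ < ε := by
  obtain ⟨σ, b, hσ, hz⟩ := exists_signs_of_unbddCoords_eq_empty hJ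
  set w : ℂ := c + L α with hw
  have hw0 : w ≠ 0 := h0 α hα
  -- Rotating by `u` makes the value at `α` positive; on `α + ker q` the rotated value is the real
  -- number `r x`.
  set u : ℂ := star w / ‖w‖ with hu
  have hun : ‖u‖ = 1 := by
    rw [hu, norm_div, norm_star, Complex.norm_real, norm_norm, div_self (norm_ne_zero_iff.2 hw0)]
  have huw : u * w = ‖w‖ := by
    have : (‖w‖ : ℂ) ≠ 0 := by exact_mod_cast norm_ne_zero_iff.2 hw0
    rw [hu, div_mul_eq_mul_div, div_eq_iff this, ← sq, Complex.star_def, Complex.conj_mul']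
  set M : (Fin n → ℝ) →ₗ[ℝ] ℂ := (LinearMap.mulLeft ℝ u).comp L
  set l : (Fin n → ℝ) →ₗ[ℝ] ℝ := Complex.reLm.comp M
  set q : (Fin n → ℝ) →ₗ[ℝ] ℝ := Complex.imLm.comp M
  have hlc : Continuous l := l.continuous_of_finiteDimensional
  set r : (Fin n → ℝ) → ℝ := fun x => (u * c).re + l x with hr
  have hval : ∀ x, x - α ∈ LinearMap.ker q → u * (c + L x) = (r x : ℂ) := by
    intro x hx
    rw [LinearMap.mem_ker, map_sub, sub_eq_zero] at hx
    have him : (u * (c + L α)).im = 0 := by rw [← hw, huw, Complex.ofReal_im]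
    have e : ∀ y, (u * (c + L y)).im = (u * c).im + q y := fun y => by
      rw [mul_add, Complex.add_im]; rfl
    apply Complex.ext
    · rw [mul_add, Complex.add_re, Complex.ofReal_re]; rfl
    · rw [e, hx, ← e, him, Complex.ofReal_im]
  have hnorm : ∀ x, x - α ∈ LinearMap.ker q → ‖c + L x‖ = |r x| := fun x hx => by
    rw [← one_mul ‖c + L x‖, ← hun, ← norm_mul, hval x hx, Complex.norm_real, Real.norm_eq_abs]
  have hrα : r α = ‖w‖ := by
    have h := hval α (by simp)
    rw [← hw, huw] at h
    exact_mod_cast h.symm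
  have hrne : ∀ x ∈ Ω, x - α ∈ LinearMap.ker q → r x ≠ 0 := fun x hx hxq h => by
    have h2 := hnorm x hxq
    rw [h, abs_zero, norm_eq_zero] at h2
    exact h0 x hx h2
  set Q : Set (Fin n → ℝ) := {x | x ∈ Ω ∧ x - α ∈ LinearMap.ker q ∧ 0 ≤ r x} with hQ
  have hQc : IsClosed Q := by
    refine hΩ.inter (IsClosed.inter ?_ (isClosed_le continuous_const (continuous_const.add hlc)))
    exact (LinearMap.ker q).closed_of_finiteDimensional.preimage
      (by fun_prop : Continuous fun y => y - α)
  have hwpos : 0 < ‖w‖ := norm_pos_iff.2 hw0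
  have hαQ : α ∈ Q := ⟨hα, by simp, by rw [hrα]; exact hwpos.le⟩
  have hlb : ∀ y ∈ Q, -(u * c).re ≤ l y := fun y hy => by
    have : 0 ≤ (u * c).re + l y := hy.2.2
    linarith
  -- small perturbations do not reach the points of `Ω` with negative value
  obtain ⟨δ₀, hδ₀, hneg⟩ : ∃ δ₀ > 0, ∀ δ, 0 < δ → δ < δ₀ → ∀ x ∈ Q, ∀ y ∈ Ω,
      y - α ∈ LinearMap.ker q → ∀ d : Fin n → ℝ, (∀ j, |d j| ≤ 1) →
      l (y - x) + δ * ∑ j, d j * (y j - x j) = 0 → y ∈ Q := by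
    rcases hΩ' with hconv | hbdd
    · refine ⟨1, one_pos, fun δ _ _ x _ y hy hyq _ _ _ => ⟨hy, hyq, ?_⟩⟩
      -- A negative value at `y` would force a zero of `r` on the segment from `α` to `y`, inside
      -- `Ω`.
      by_contra hlt
      rw [not_le] at hlt
      have hpos : 0 < r α - r y := by rw [hrα]; linarith
      have hz1 : α + (‖w‖ / (r α - r y)) • (y - α) ∈ Ω := by
        refine hconv.add_smul_sub_mem hα hy ⟨by positivity, ?_⟩
        rw [div_le_one hpos, hrα]; linarith
      refine hrne _ hz1 ?_ ?_
      · rw [add_sub_cancel_left]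
        exact Submodule.smul_mem _ _ hyq
      · have e : r (α + (‖w‖ / (r α - r y)) • (y - α)) =
            r α + (‖w‖ / (r α - r y)) * (r y - r α) := by
          simp only [hr, map_add, map_smul, map_sub, smul_eq_mul]
          ring
        rw [e, hrα]
        rw [hrα] at hpos
        field_simp
        ring
    · have hΩcomp := Metric.isCompact_of_isClosed_isBounded hΩ hbdd
      have hLc : Continuous L := L.continuous_of_finiteDimensional
      obtain ⟨x₀, hx₀, hmin⟩ := hΩcomp.exists_isMinOn ⟨α, hα⟩
        (f := fun x => ‖c + L x‖) (by fun_prop)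
      have hs : 0 < ‖c + L x₀‖ := norm_pos_iff.2 (h0 x₀ hx₀)
      obtain ⟨D, hD⟩ := Metric.isBounded_iff.1 hbdd
      have hD0 : 0 ≤ D := dist_nonneg.trans (hD hα hα)
      -- On the isolating plane `r` changes by at most `δ n D`, less than the minimum modulus on
      -- `Ω`, so it cannot become negative.
      refine ⟨‖c + L x₀‖ / (n * D + 1), by positivity, fun δ hδ hδ' x hx y hy hyq d hd h => ?_⟩
      refine ⟨hy, hyq, ?_⟩
      have h1 : |∑ j, d j * (y j - x j)| ≤ n * D := by
        refine (Finset.abs_sum_le_sum_abs _ _).trans ?_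
        refine (Finset.sum_le_card_nsmul _ _ D fun j _ => ?_).trans (by simp)
        rw [abs_mul]
        have h2 : |y j - x j| ≤ D := (dist_le_pi_dist y x j).trans (hD hy hx.1)
        nlinarith [hd j, abs_nonneg (d j), abs_nonneg (y j - x j)]
      rw [lt_div_iff₀ (by positivity)] at hδ'
      have h3 : ‖c + L x₀‖ ≤ r x := by
        have h4 : ‖c + L x₀‖ ≤ ‖c + L x‖ := hmin hx.1
        rwa [hnorm x hx.2.1, abs_of_nonneg hx.2.2] at h4
      have h5 : r y - r x = l (y - x) := by simp only [hr, map_sub]; ring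
      have h6 := (abs_le.1 h1).2
      have h7 := mul_le_mul_of_nonneg_left h6 hδ.le
      linarith
  set B := ∑ j, √(σ j * α j + b j) with hB
  have hB0 : 0 ≤ B := Finset.sum_nonneg fun _ _ => Real.sqrt_nonneg _
  -- The first bound keeps `δ < δ₀`; the second gives `‖w‖ + δ B < ε`.
  set δ := min (δ₀ / 2) ((ε - ‖w‖) / (B + 1))
  have hgap : 0 < ε - ‖w‖ := sub_pos.2 hαε
  have hδ : 0 < δ := lt_min (by linarith) (by positivity)
  have hδ1 : δ < δ₀ := (min_le_left _ _).trans_lt (by linarith)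
  have hδ2 : δ * (B + 1) ≤ ε - ‖w‖ := by
    rw [← le_div_iff₀ (by positivity)]; exact min_le_right _ _
  obtain ⟨x, hx, hxl, d, hd, hmin⟩ := exists_strict_minimizer hQc hσ (fun y hy => hz y hy.1) l
    hlb hαQ hδ
  refine ⟨x, mem_baseSkeleton_of_isolated hm hx.1 (LinearMap.ker q)
    (by have := le_finrank_ker_add_one q; omega)
    (l + δ • ∑ j, d j • LinearMap.proj j) fun y hy hyV hp => ?_, ?_⟩
  · have hyq : y - α ∈ LinearMap.ker q := by
      simpa using Submodule.add_mem _ hyV hx.2.1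
    have hp' : l (y - x) + δ * ∑ j, d j * (y j - x j) = 0 := by
      simpa using hp
    by_contra hyx
    exact (hmin y (hneg δ hδ hδ1 x hx y hy hyq d hd hp') hyx).ne' hp'
  · rw [hnorm x hx.2.1, abs_of_nonneg hx.2.2]
    have e1 : r x = (u * c).re + l x := rfl
    have e2 : (u * c).re + l α = ‖w‖ := hrα
    rw [← hB] at hxl
    linarith

/-- Closedness, convexity or boundedness, and absence of zeros all survive cutting by half-spaces.
The case `n = 2` is separate because the `0`-skeleton is a frontier. -/
theorem exists_mem_natSkeleton_norm_lt {n : ℕ} (hn : 2 ≤ n) {Ω : Set (Fin n → ℝ)}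
    (hΩ : IsClosed Ω) (hΩ' : n = 2 ∨ Convex ℝ Ω ∨ Bornology.IsBounded Ω)
    (L : (Fin n → ℝ) →ₗ[ℝ] ℂ) (c : ℂ) (h0 : ∀ x ∈ Ω, c + L x ≠ 0) {ε : ℝ}
    {α : Fin n → ℝ} (hα : α ∈ Ω) (hαε : ‖c + L α‖ < ε) :
    ∃ x ∈ natSkeleton (n - 2) Ω, ‖c + L x‖ < ε := by
  refine exists_mem_natSkeleton (n - 2)
    (fun Ω => IsClosed Ω ∧ (n = 2 ∨ Convex ℝ Ω ∨ Bornology.IsBounded Ω) ∧ ∀ x ∈ Ω, c + L x ≠ 0)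
    (fun x => ‖c + L x‖ < ε)
    (fun Ω j h => ⟨isClosed_sep_nonneg h.1 j, h.2.1.imp id (Or.imp (convex_sep_nonneg · j)
      (·.subset (Set.sep_subset _ _))), fun x hx => h.2.2 x hx.1⟩)
    (fun Ω j h => ⟨isClosed_sep_nonpos h.1 j, h.2.1.imp id (Or.imp (convex_sep_nonpos · j)
      (·.subset (Set.sep_subset _ _))), fun x hx => h.2.2 x hx.1⟩)
    (fun Ω h hJ y hy hyε => ?_) Ω ⟨hΩ, hΩ', h0⟩ α hα hαε
  obtain ⟨hc, hcb, h0⟩ := h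
  rcases eq_or_ne n 2 with rfl | hn2
  · simpa [baseSkeleton] using exists_mem_frontier_norm_lt hJ L c h0 hy hyε
  · exact exists_mem_baseSkeleton_norm_lt (by omega) (by omega) hc (hcb.resolve_left hn2) hJ L c
      h0 hy hyε

/-! ### The affine map `α ↦ t_α(ω)` and its kernel -/

/-- The linear part of `α ↦ t_α(ω)`. -/
noncomputable def coeffMap {n : ℕ} (f : Fin n → ℂ → ℂ) (ω : ℂ) : (Fin n → ℝ) →ₗ[ℝ] ℂ :=
  Fintype.linearCombination ℝ fun j => f j ω

theorem coeffMap_apply {n : ℕ} (f : Fin n → ℂ → ℂ) (ω : ℂ) (α : Fin n → ℝ) :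
    coeffMap f ω α = ∑ j, (α j : ℂ) * f j ω := by
  simp [coeffMap, Fintype.linearCombination_apply]

theorem tFun_eq {n : ℕ} (f : Fin n → ℂ → ℂ) (g : ℂ → ℂ) (α : Fin n → ℝ) (ω : ℂ) :
    tFun f g α ω = g ω + coeffMap f ω α := by
  rw [coeffMap_apply, tFun]

theorem ker_coeffMap {n : ℕ} (f : Fin n → ℂ → ℂ) (ω : ℂ) :
    LinearMap.ker (coeffMap f ω) = LinearMap.ker (coeffMatrix f ω).mulVecLin := by
  ext α
  have h1 : (coeffMatrix f ω).mulVec α 0 = (coeffMap f ω α).re := by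
    simp [coeffMap_apply, coeffMatrix, Matrix.mulVec, dotProduct, mul_comm]
  have h2 : (coeffMatrix f ω).mulVec α 1 = (coeffMap f ω α).im := by
    simp [coeffMap_apply, coeffMatrix, Matrix.mulVec, dotProduct, mul_comm]
  rw [LinearMap.mem_ker, LinearMap.mem_ker, Matrix.mulVecLin_apply, funext_iff, Fin.forall_fin_two,
    h1, h2, Complex.ext_iff]
  rfl

theorem le_finrank_ker_coeffMap_of_rank_lt {n : ℕ} {f : Fin n → ℂ → ℂ} {ω : ℂ}
    (h : (coeffMatrix f ω).rank < 2) :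
    n ≤ Module.finrank ℝ (LinearMap.ker (coeffMap f ω)) + 1 := by
  have h1 := LinearMap.finrank_range_add_finrank_ker (coeffMatrix f ω).mulVecLin
  rw [Matrix.rank] at h
  rw [ker_coeffMap]
  simp at h1
  omega

theorem exists_mem_skeleton_norm_lt {n : ℕ} (f : Fin n → ℂ → ℂ) (g : ℂ → ℂ)
    {Ω : Set (Fin n → ℝ)} (hΩ : IsClosed Ω) {ω : ℂ} (h0 : ∀ α ∈ Ω, tFun f g α ω ≠ 0) {ε : ℝ}
    {α : Fin n → ℝ} (hα : α ∈ Ω) (hαε : ‖tFun f g α ω‖ < ε) :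
    ∃ x ∈ skeleton (skeletonIndex Ω) Ω, ‖tFun f g x ω‖ < ε := by
  simp only [tFun_eq] at h0 hαε ⊢
  by_cases hneg : skeletonIndex Ω < 0
  · rw [skeleton, if_pos hneg]
    exact ⟨α, hα, hαε⟩
  rw [skeleton, if_neg hneg]
  rw [skeletonIndex] at hneg ⊢
  split_ifs at hneg ⊢ with h
  · have e : ((n : ℤ) - 2).toNat = n - 2 := by omega
    rw [e]
    exact exists_mem_natSkeleton_norm_lt (by omega) hΩ h _ _ h0 hα hαε
  -- The fibres have dimension at least `n - 2 = (n - 3) + 1`, so the value can be kept exactly.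
  · have := le_finrank_ker_add_two (coeffMap f ω)
    obtain ⟨x, hx, hxα⟩ := exists_mem_natSkeleton_eq (m := ((n : ℤ) - 3).toNat) hΩ (coeffMap f ω)
      (by omega) hα
    exact ⟨x, hx, by rwa [hxα]⟩

theorem exists_mem_skeleton_norm_lt_of_rank_lt {n : ℕ} (f : Fin n → ℂ → ℂ) (g : ℂ → ℂ)
    {Ω : Set (Fin n → ℝ)} (hΩ : IsClosed Ω) {ω : ℂ} (hω : (coeffMatrix f ω).rank < 2) {ε : ℝ}
    {α : Fin n → ℝ} (hα : α ∈ Ω) (hαε : ‖tFun f g α ω‖ < ε) :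
    ∃ x ∈ skeleton ((n : ℤ) - 2) Ω, ‖tFun f g x ω‖ < ε := by
  simp only [tFun_eq] at hαε ⊢
  rw [skeleton]
  split_ifs with hneg
  · exact ⟨α, hα, hαε⟩
  · have := le_finrank_ker_coeffMap_of_rank_lt hω
    obtain ⟨x, hx, hxα⟩ := exists_mem_natSkeleton_eq (m := ((n : ℤ) - 2).toNat) hΩ (coeffMap f ω)
      (by omega) hα
    exact ⟨x, hx, by rwa [hxα]⟩

/-! ### Boundaries of the pseudo-enclosures -/

section Boundary

variable {n : ℕ} {𝒞 : Set ℂ} {f : Fin n → ℂ → ℂ} {g : ℂ → ℂ} {Ω : Set (Fin n → ℝ)} {ω : ℂ}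

theorem bddBelow_norm_tFun : BddBelow ((fun α => ‖tFun f g α ω‖) '' Ω) :=
  ⟨0, by rintro _ ⟨α, -, rfl⟩; exact norm_nonneg _⟩

theorem infModulus_le {α : Fin n → ℝ} (hα : α ∈ Ω) : infModulus f g Ω ω ≤ ‖tFun f g α ω‖ :=
  csInf_le bddBelow_norm_tFun ⟨α, hα, rfl⟩

theorem exists_norm_tFun_lt (hΩ : Ω.Nonempty) {ε : ℝ} (h : infModulus f g Ω ω < ε) :
    ∃ α ∈ Ω, ‖tFun f g α ω‖ < ε := by
  obtain ⟨_, ⟨α, hα, rfl⟩, h⟩ := exists_lt_of_csInf_lt (hΩ.image _) h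
  exact ⟨α, hα, h⟩

theorem pseudoEnclosure_mono {ε ε' : ℝ} (h : ε ≤ ε') :
    pseudoEnclosure 𝒞 f g Ω ε ⊆ pseudoEnclosure 𝒞 f g Ω ε' :=
  fun _ ⟨hz, α, hα, hαz⟩ => ⟨hz, α, hα, hαz.trans_le h⟩

theorem continuousAt_tFun (hω : ω ∈ contSet 𝒞 f g) (α : Fin n → ℝ) :
    ContinuousAt (tFun f g α) ω := by
  obtain ⟨-, hg, hf⟩ := hω
  exact hg.add (tendsto_finsetSum _ fun j _ => continuousAt_const.mul (hf j))

theorem mem_interior_pseudoEnclosure (h𝒞 : IsOpen 𝒞) (hΩ : Ω.Nonempty)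
    (hω : ω ∈ contSet 𝒞 f g) {ε : ℝ} (h : infModulus f g Ω ω < ε) :
    ω ∈ interior (pseudoEnclosure 𝒞 f g Ω ε) := by
  obtain ⟨α, hα, hαω⟩ := exists_norm_tFun_lt hΩ h
  rw [mem_interior_iff_mem_nhds]
  filter_upwards [h𝒞.mem_nhds hω.1, (continuousAt_tFun hω α).norm.eventually_lt_const hαω]
    with z hz hαz
  exact ⟨hz, α, hα, hαz⟩

theorem notMem_pseudoEnclosure {ε : ℝ} (h : ε ≤ infModulus f g Ω ω) :
    ω ∉ pseudoEnclosure 𝒞 f g Ω ε := fun ⟨_, _, hα, hαω⟩ =>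
  absurd (h.trans (infModulus_le hα)) (not_le.2 hαω)

theorem infModulus_eq_of_mem_frontier (h𝒞 : IsOpen 𝒞) (hω : ω ∈ contSet 𝒞 f g) {ε : ℝ}
    (h : ω ∈ frontier (pseudoEnclosure 𝒞 f g Ω ε))
    (h' : ∀ ε' > ε, ω ∉ frontier (pseudoEnclosure 𝒞 f g Ω ε')) : infModulus f g Ω ω = ε := by
  -- A boundary point forces `Ω` to be nonempty, so the infimum is not the default value `0`.
  obtain ⟨_, -, α, hα, -⟩ := closure_nonempty_iff.1 ⟨ω, h.1⟩
  refine le_antisymm (not_lt.1 fun hlt => ?_)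
    (not_lt.1 fun hlt => h.2 (mem_interior_pseudoEnclosure h𝒞 ⟨α, hα⟩ hω hlt))
  obtain ⟨ε', h1, h2⟩ := exists_between hlt
  exact h' ε' h1 ⟨closure_mono (pseudoEnclosure_mono h1.le) h.1,
    fun hi => notMem_pseudoEnclosure h2.le (interior_subset hi)⟩

theorem holoSet_subset_contSet {ε : ℝ} : holoSet 𝒞 f g Ω ε ⊆ contSet 𝒞 f g :=
  fun _ hω => ⟨hω.1, hω.2.1.continuousAt, fun j => (hω.2.2.1 j).continuousAt⟩

theorem analyticAt_sum_mul (hf : ∀ j, AnalyticAt ℂ (f j) ω) (α : Fin n → ℝ) :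
    AnalyticAt ℂ (fun z => ∑ j, (α j : ℂ) * f j z) ω :=
  Finset.analyticAt_fun_sum _ fun j _ => analyticAt_const.mul (hf j)

theorem eventually_sum_mul_ne_zero {ε : ℝ} (hω : ω ∈ holoSet 𝒞 f g Ω ε) {β : Fin n → ℝ}
    (hβ : β ≠ 0) : ∀ᶠ z in 𝓝[≠] ω, ∑ j, (β j : ℂ) * f j z ≠ 0 := by
  obtain ⟨-, -, hf, hli, -⟩ := hω
  refine (analyticAt_sum_mul hf β).eventually_eq_zero_or_eventually_ne_zero.resolve_left
    fun h => hβ ?_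
  -- A vanishing combination of the `f j` is a relation between the germs, with coefficient `0` on
  -- `g`.
  rw [Fintype.linearIndependent_iff] at hli
  have h0 := hli (Fin.cons 0 β) (by
    rw [Fin.sum_univ_succ]
    simp only [Fin.cons_zero, zero_smul, zero_add, Fin.cons_succ]
    have e : ∀ j, β j • ((f j : ℂ → ℂ) : Germ (𝓝 ω) ℂ) =
        Germ.coeRingHom (𝓝 ω) (fun z => (β j : ℂ) * f j z) := fun j => by
      rw [← Germ.coe_smul]
      simp only [← Complex.real_smul]
      rfl
    simp only [e, ← map_sum]
    refine Germ.coe_eq.2 ?_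
    filter_upwards [h] with z hz
    rw [Finset.sum_apply]
    exact hz)
  ext j
  simpa using h0 j.succ

theorem eventually_norm_eq_of_eventually_le {F : ℂ → ℂ} {ε : ℝ} (hF : AnalyticAt ℂ F ω)
    (hε : 0 < ε) (hFω : ‖F ω‖ = ε) (h : ∀ᶠ z in 𝓝 ω, ε ≤ ‖F z‖) : ∀ᶠ z in 𝓝 ω, ‖F z‖ = ε := by
  have hmin : IsLocalMin (norm ∘ F) ω := h.mono fun z hz => by simpa [hFω] using hz
  have hd : ∀ᶠ z in 𝓝 ω, DifferentiableAt ℂ F z :=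
    hF.eventually_analyticAt.mono fun z hz => hz.differentiableAt
  rcases Complex.eventually_eq_or_eq_zero_of_isLocalMin_norm hd hmin with h | h
  · exact h.mono fun z hz => by rw [hz, hFω]
  · rw [h, norm_zero] at hFω
    exact absurd hFω hε.ne

/-- Minimum modulus principle on a disc. -/
theorem le_norm_center_of_le_norm_sphere {F : ℂ → ℂ} {r m : ℝ} (hr : 0 < r) (hm : 0 < m)
    (hF : ∀ z ∈ Metric.closedBall ω r, DifferentiableAt ℂ F z)
    (h0 : ∀ z ∈ Metric.closedBall ω r, F z ≠ 0)
    (h : ∀ z ∈ Metric.sphere ω r, m ≤ ‖F z‖) : m ≤ ‖F ω‖ := by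
  -- The maximum principle is applied to `1 / F`.
  have hd : DiffContOnCl ℂ (fun z => (F z)⁻¹) (Metric.ball ω r) := by
    refine DifferentiableOn.diffContOnCl fun z hz => ?_
    rw [closure_ball ω hr.ne'] at hz
    exact ((hF z hz).inv (h0 z hz)).differentiableWithinAt
  have hle := Complex.norm_le_of_forall_mem_frontier_norm_le Metric.isBounded_ball hd (C := m⁻¹)
    (fun z hz => by
      rw [frontier_ball ω hr.ne'] at hz
      rw [norm_inv]
      exact inv_anti₀ hm (h z hz)) (subset_closure (Metric.mem_ball_self hr))
  rw [norm_inv] at hle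
  exact (inv_le_inv₀ (norm_pos_iff.2 (h0 ω (Metric.mem_closedBall_self hr.le))) hm).1 hle

/-- If all `|t_α|`, `α ∈ Ω`, are bounded below near `ω`, then `|t_α(ω)|` is bounded only on bounded
subsets of `Ω`. -/
theorem isBounded_setOf_norm_tFun_le {ε : ℝ} (hω : ω ∈ holoSet 𝒞 f g Ω ε) (hε : 0 < ε)
    (h : ∀ᶠ z in 𝓝 ω, ∀ α ∈ Ω, ε ≤ ‖tFun f g α z‖) (M : ℝ) :
    Bornology.IsBounded {α ∈ Ω | ‖tFun f g α ω‖ ≤ M} := by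
  by_contra hub
  have hex : ∀ k : ℕ, ∃ α ∈ Ω, ‖tFun f g α ω‖ ≤ M ∧ (k : ℝ) + 1 ≤ ‖α‖ := by
    by_contra! hcon
    obtain ⟨k, hk⟩ := hcon
    refine hub (isBounded_iff_forall_norm_le.2 ⟨k + 1, fun α hα => (hk α hα.1 hα.2).le⟩)
  choose a haΩ haM hak using hex
  have ha0 : ∀ k, 0 < ‖a k‖ := fun k => lt_of_lt_of_le (by positivity) (hak k)
  -- The directions of an unbounded sequence accumulate at a unit vector `β`. Since `∑ β_j f_j` has
  -- no zero on a small circle, `|t_{a_k}|` becomes large there, and the minimum modulus principle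
  -- carries this to `ω`.
  obtain ⟨β, hβ, φ, hφ, hlim⟩ := (isCompact_sphere (0 : Fin n → ℝ) 1).tendsto_subseq
    (x := fun k => ‖a k‖⁻¹ • a k) (fun k => by
      rw [mem_sphere_zero_iff_norm, norm_smul, norm_inv, norm_norm,
        inv_mul_cancel₀ (ha0 k).ne'])
  have hβ0 : β ≠ 0 := by
    rintro rfl
    simp at hβ
  have hne := eventually_sum_mul_ne_zero hω hβ0
  obtain ⟨-, hg, hf, -, -⟩ := hω
  rw [eventually_nhdsWithin_iff] at hne
  have hall := (h.and hne).and (hg.eventually_analyticAt.and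
    (eventually_all.2 fun j => (hf j).eventually_analyticAt))
  obtain ⟨r, hr, hball⟩ := Metric.nhds_basis_closedBall.eventually_iff.1 hall
  have hSsub : Metric.sphere ω r ⊆ Metric.closedBall ω r := Metric.sphere_subset_closedBall
  have hfc : ∀ j, ContinuousOn (f j) (Metric.sphere ω r) := fun j z hz =>
    ((hball (hSsub hz)).2.2 j).continuousAt.continuousWithinAt
  have hgc : ContinuousOn g (Metric.sphere ω r) := fun z hz =>
    (hball (hSsub hz)).2.1.continuousAt.continuousWithinAt
  have hScomp := isCompact_sphere ω r
  have hSne : (Metric.sphere ω r).Nonempty := NormedSpace.sphere_nonempty.2 hr.le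
  obtain ⟨z₀, hz₀, hz₀min⟩ := hScomp.exists_isMinOn hSne
    (f := fun z => ‖∑ j, (β j : ℂ) * f j z‖)
    (continuousOn_finsetSum _ fun j _ => continuousOn_const.mul (hfc j)).norm
  set μ := ‖∑ j, (β j : ℂ) * f j z₀‖
  have hμ : 0 < μ := norm_pos_iff.2
    ((hball (hSsub hz₀)).1.2 fun h => by
      rw [Set.mem_singleton_iff.1 h] at hz₀
      simp [hr.ne] at hz₀)
  obtain ⟨G, hG⟩ := hScomp.exists_bound_of_continuousOn hgc
  obtain ⟨B, hB⟩ := hScomp.exists_bound_of_continuousOn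
    (continuousOn_finsetSum Finset.univ fun j _ => (hfc j).norm)
  have hB0 : 0 ≤ B := (norm_nonneg _).trans (hB z₀ hz₀)
  -- Replacing `β` by the actual direction then costs at most `μ / 2` on the circle; the threshold
  -- in `hev2` absorbs `g` and still leaves `|M| + 1`.
  have hev1 : ∀ᶠ k in atTop, ‖‖a (φ k)‖⁻¹ • a (φ k) - β‖ < μ / (2 * (B + 1)) := by
    have := tendsto_iff_norm_sub_tendsto_zero.1 hlim
    exact this.eventually_lt_const (by positivity)
  have hnorm : Tendsto (fun k => ‖a (φ k)‖) atTop atTop := by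
    refine tendsto_atTop_mono (fun k => ?_) (tendsto_natCast_atTop_atTop (R := ℝ))
    have h1 : (k : ℝ) ≤ φ k := by exact_mod_cast hφ.id_le k
    have h2 := hak (φ k)
    linarith
  have hev2 := hnorm.eventually_ge_atTop (2 * (G + |M| + 1) / μ)
  obtain ⟨k, hk1, hk2⟩ := (hev1.and hev2).exists
  set s := ‖a (φ k)‖
  have hs0 : 0 < s := ha0 _
  set γ := s⁻¹ • a (φ k) with hγ
  have hlow : ∀ z ∈ Metric.sphere ω r, |M| + 1 ≤ ‖tFun f g (a (φ k)) z‖ := by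
    intro z hz
    have e : tFun f g (a (φ k)) z =
        s * (∑ j, (β j : ℂ) * f j z + ∑ j, ((γ - β) j : ℂ) * f j z) + g z := by
      have : ∀ j, ((a (φ k) j : ℝ) : ℂ) = s * (γ j : ℂ) := fun j => by
        rw [hγ, Pi.smul_apply, smul_eq_mul, ← Complex.ofReal_mul, mul_inv_cancel_left₀ hs0.ne']
      rw [tFun, add_comm, ← Finset.sum_add_distrib, Finset.mul_sum]
      congr 1
      refine Finset.sum_congr rfl fun j _ => ?_
      rw [this, Pi.sub_apply]
      push_cast
      ring
    have h1 : μ ≤ ‖∑ j, (β j : ℂ) * f j z‖ := hz₀min hz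
    have h2 : ‖∑ j, ((γ - β) j : ℂ) * f j z‖ ≤ μ / 2 := by
      calc ‖∑ j, ((γ - β) j : ℂ) * f j z‖ ≤ ∑ j, ‖γ - β‖ * ‖f j z‖ := by
            refine norm_sum_le_of_le _ fun j _ => ?_
            rw [norm_mul, Complex.norm_real]
            exact mul_le_mul_of_nonneg_right (norm_le_pi_norm _ j) (norm_nonneg _)
        _ = ‖γ - β‖ * ∑ j, ‖f j z‖ := by rw [Finset.mul_sum]
        _ ≤ ‖γ - β‖ * (B + 1) := by
            refine mul_le_mul_of_nonneg_left ?_ (norm_nonneg _)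
            have := (le_abs_self _).trans (hB z hz)
            linarith
        _ ≤ μ / (2 * (B + 1)) * (B + 1) :=
            mul_le_mul_of_nonneg_right hk1.le (by positivity)
        _ = μ / 2 := by field_simp
    have h3 := norm_sub_le_norm_add (∑ j, (β j : ℂ) * f j z) (∑ j, ((γ - β) j : ℂ) * f j z)
    have h4 := norm_sub_le_norm_add
      (s * (∑ j, (β j : ℂ) * f j z + ∑ j, ((γ - β) j : ℂ) * f j z)) (g z)
    have h5 := hG z hz
    rw [div_le_iff₀ hμ] at hk2
    rw [e]
    rw [norm_mul, Complex.norm_real, Real.norm_of_nonneg hs0.le] at h4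
    have h6 : s * (μ / 2) ≤
        s * ‖∑ j, (β j : ℂ) * f j z + ∑ j, ((γ - β) j : ℂ) * f j z‖ :=
      mul_le_mul_of_nonneg_left (by linarith) hs0.le
    linarith
  have hfin := le_norm_center_of_le_norm_sphere hr (by positivity : 0 < |M| + 1)
    (F := tFun f g (a (φ k)))
    (fun z hz => ((hball hz).2.1.add (analyticAt_sum_mul (hball hz).2.2 _)).differentiableAt)
    (fun z hz h0 => by
      have := (hball hz).1.1 _ (haΩ (φ k))
      rw [h0, norm_zero] at this
      linarith) hlow
  have := haM (φ k)
  have := le_abs_self M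
  linarith

theorem mem_closure_pseudoEnclosure (h𝒞 : IsOpen 𝒞) (hΩ : IsClosed Ω) (hΩne : Ω.Nonempty)
    {ε : ℝ} (hε : 0 < ε) (hω : ω ∈ holoSet 𝒞 f g Ω ε) (h : infModulus f g Ω ω = ε) :
    ω ∈ closure (pseudoEnclosure 𝒞 f g Ω ε) := by
  by_contra hcl
  have hlow : ∀ᶠ z in 𝓝 ω, ∀ α ∈ Ω, ε ≤ ‖tFun f g α z‖ := by
    filter_upwards [isClosed_closure.isOpen_compl.mem_nhds hcl, h𝒞.mem_nhds hω.1]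
      with z hz hz𝒞 α hα
    exact not_lt.1 fun hlt => hz (subset_closure ⟨hz𝒞, α, hα, hlt⟩)
  have hcont : Continuous fun α : Fin n → ℝ => ‖tFun f g α ω‖ := by
    simp only [tFun]
    fun_prop
  have hcomp : IsCompact {α ∈ Ω | ‖tFun f g α ω‖ ≤ ε + 1} :=
    Metric.isCompact_of_isClosed_isBounded
      (hΩ.inter (isClosed_le hcont continuous_const)) (isBounded_setOf_norm_tFun_le hω hε hlow _)
  -- The level `ε + 1` exceeds the infimum, so this compact set is nonempty and a minimizer on it is
  -- global.
  obtain ⟨α₁, hα₁, hα₁ε⟩ := exists_norm_tFun_lt hΩne (by linarith : infModulus f g Ω ω < ε + 1)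
  obtain ⟨α, hα, hmin⟩ := hcomp.exists_isMinOn ⟨α₁, hα₁, hα₁ε.le⟩ hcont.continuousOn
  have hαε : ‖tFun f g α ω‖ = ε := by
    refine le_antisymm (not_lt.1 fun hlt => ?_) (hlow.self_of_nhds α hα.1)
    obtain ⟨α₂, hα₂, hlt₂⟩ := exists_norm_tFun_lt hΩne (h.trans_lt hlt)
    exact absurd (hmin ⟨hα₂, hlt₂.le.trans hα.2⟩ : ‖tFun f g α ω‖ ≤ ‖tFun f g α₂ ω‖)
      (not_le.2 hlt₂)
  exact hω.2.2.2.2 α hα.1 (eventually_norm_eq_of_eventually_le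
    (hω.2.1.add (analyticAt_sum_mul hω.2.2.1 α)) hε hαε (hlow.mono fun z hz => hz α hα.1))

end Boundary

/-! ### The four assertions -/

theorem mainTheorem3 {E : Type*} [NormedAddCommGroup E] [InnerProductSpace ℂ E] [CompleteSpace E]
    {n : ℕ} (hn : 1 ≤ n)
    (A : Fin n → E →ₗ.[ℂ] E) (hA : ∀ j, IsSelfAdjoint (A j))
    (hdense : Dense (commonDomain A : Set E))
    (𝒞 : Set ℂ) (h𝒞_open : IsOpen 𝒞) (h𝒞_dense : Dense 𝒞)
    (f : Fin n → ℂ → ℂ) (g : ℂ → ℂ)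
    (hclosable : ∀ ω ∈ 𝒞, (preOperator A f g ω).IsClosable)
    (Ω : Set (Fin n → ℝ)) (hΩ_closed : IsClosed Ω)
    (hΩ_lower : jointNumRange A ⊆ Ω)
    (hΩ_upper : Ω ⊆ Set.univ.pi (fun j => closure (numRange (A j))))
    (ε : ℝ) (hε : 0 < ε) :
    (pseudoEnclosure 𝒞 f g (skeleton (skeletonIndex Ω) Ω) ε \ enclosure 𝒞 f g Ω =
      pseudoEnclosure 𝒞 f g Ω ε \ enclosure 𝒞 f g Ω) ∧
    ((pseudoEnclosure 𝒞 f g (skeleton ((n : ℤ) - 2) Ω) ε ∩ degenerateSet 𝒞 f) \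
        enclosure 𝒞 f g Ω =
      (pseudoEnclosure 𝒞 f g Ω ε ∩ degenerateSet 𝒞 f) \ enclosure 𝒞 f g Ω) ∧
    ({ω | ω ∈ frontier (pseudoEnclosure 𝒞 f g Ω ε) ∩ contSet 𝒞 f g ∧
        ∀ ε' > ε, ω ∉ frontier (pseudoEnclosure 𝒞 f g Ω ε')} ⊆
      {ω | ω ∈ contSet 𝒞 f g ∧ infModulus f g Ω ω = ε}) ∧
    ({ω | ω ∈ frontier (pseudoEnclosure 𝒞 f g Ω ε) ∩ holoSet 𝒞 f g Ω ε ∧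
        ∀ ε' > ε, ω ∉ frontier (pseudoEnclosure 𝒞 f g Ω ε')} =
      {ω | ω ∈ holoSet 𝒞 f g Ω ε ∧ infModulus f g Ω ω = ε}) := by

  refine ⟨?_, ?_, ?_, ?_⟩
  · ext ω
    refine and_congr_left fun hω => and_congr_right fun h𝒞 => ⟨?_, ?_⟩
    · rintro ⟨α, hα, hlt⟩
      exact ⟨α, skeleton_subset _ hΩ_closed hα, hlt⟩
    · rintro ⟨α, hα, hlt⟩
      exact exists_mem_skeleton_norm_lt f g hΩ_closed (fun x hx h0 => hω ⟨h𝒞, x, hx, h0⟩) hα hlt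
  · ext ω
    refine and_congr_left fun _ => and_congr_left fun hdeg => and_congr_right fun _ => ⟨?_, ?_⟩
    · rintro ⟨α, hα, hlt⟩
      exact ⟨α, skeleton_subset _ hΩ_closed hα, hlt⟩
    · rintro ⟨α, hα, hlt⟩
      exact exists_mem_skeleton_norm_lt_of_rank_lt f g hΩ_closed hdeg.2 hα hlt
  · rintro ω ⟨⟨hfr, hc⟩, h⟩
    exact ⟨hc, infModulus_eq_of_mem_frontier h𝒞_open hc hfr h⟩
  · ext ω
    constructor
    · rintro ⟨⟨hfr, hω⟩, h⟩
      exact ⟨hω, infModulus_eq_of_mem_frontier h𝒞_open (holoSet_subset_contSet hω) hfr h⟩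
    · rintro ⟨hω, h⟩
      -- For empty `Ω` the infimum defaults to `0`, which is not `ε`.
      have hne : Ω.Nonempty := by
        by_contra hemp
        rw [Set.not_nonempty_iff_eq_empty.1 hemp, infModulus, Set.image_empty,
          Real.sInf_empty] at h
        exact hε.ne h
      refine ⟨⟨⟨mem_closure_pseudoEnclosure h𝒞_open hΩ_closed hne hε hω h,
        fun hi => notMem_pseudoEnclosure h.ge (interior_subset hi)⟩, hω⟩, fun ε' hε' hfr => ?_⟩
      exact hfr.2 (mem_interior_pseudoEnclosure h𝒞_open hne (holoSet_subset_contSet hω)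
        (h.trans_lt hε'))
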